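/- Let $\mathcal G$ be a connected undirected simple graph on the agents $[n]$, and let $W$ be an $n\times n$ matrix of nonnegative weights with $W_{ij}>0$ if and only if $\{i,j\}$ is an edge of $\mathcal G$. Let $A$ be the diagonal matrix with $A_{ii}=\sum_j W_{ij}$ and suppose $A_{ii}\le 1$ for all $i$; if $\mathcal G$ is bipartite, suppose also that $A_{ii}<1$ for at least one $i$. Each agent $i$ has an initial sample $X_i\in[M]$; let $\Pi\in\mathbb R^M$ be the row vector $\Pi(m)=\frac1n|\{i: X_i=m\}|$, let $\mathbf e_m\in\mathbb R^M$ be the $m$-th elementary row vector, and let $\mathbf 1\in\mathbb R^n$ be the all-ones column vector. Let $\mathbf Q(t)$ and $\mathbf Y(t)$, $t=0,1,2,\ldots$, be random $n\times M$ matrices with rows $Q_i(t)$ and $Y_i(t)$ such that $Q_i(0)=\mathbf e_{X_i}$, $$\mathbf Q(t+1)=(I-A)\,\mathbf Q(t)+W\,\mathbf Y(t),$$ every message $Y_i(t)$ lies in $\{\mathbf 0,\mathbf e_1,\ldots,\mathbf e_M\}$, and, conditionally on $\mathbf Q(0),\ldots,\mathbf Q(t)$, the messages $Y_1(t),\ldots,Y_n(t)$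 are independent with $\mathbb P(Y_i(t)=\mathbf e_m\mid \mathbf Q(0),\ldots,\mathbf Q(t))=Q_{i,m}(t)$ for all $m\in[M]$ (that is, $\mathbf P(t)=\mathbf Q(t)$). Then there is a random vector $\mathbf q^*$ with values in $\{\mathbf e_1,\ldots,\mathbf e_M\}$ such that $\mathbf Q(t)\to\mathbf Q^*:=\mathbf 1\mathbf q^*$ almost surely. If, moreover, $\sum_i W_{ij}=A_{jj}$ for every $j$ (in particular, if $W$ is symmetric, so that $A-W$ is the Laplacian of an undirected weighted graph), then $\mathbb E[\mathbf Q^*]=\mathbf 1\Pi$. -/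

import Mathlib

open MeasureTheory ProbabilityTheory Filter Topology

noncomputable section

namespace SocialSampling

/-- The vector of a message: `none` is the silent message `0`, and `some m` is the elementary
vector `e_m`. The range of this map is the message alphabet `{0, e_1, …, e_M}`. -/
def msgVec {M : ℕ} : Option (Fin M) → Fin M → ℝ
  | none => 0
  | some m => Pi.single m 1

/-- The probability of each message under a row vector `p` with `p m = P(message = e_m)`;
the remaining mass is that of the silent message. -/
def msgProb {M : ℕ} (p : Fin M → ℝ) : Option (Fin M) → ℝ
  | none => 1 - ∑ m, p m
  | some m => p m

/-- The empirical distribution `Π` of the initial samples. -/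
def empirical {n M : ℕ} (X : Fin n → Fin M) (m : Fin M) : ℝ :=
  (1 / (n : ℝ)) * ∑ i, if X i = m then (1 : ℝ) else 0

/-- The rank-one matrix `1 q` all of whose rows are equal to `q`. -/
def consensus (n : ℕ) {M : ℕ} (q : Fin M → ℝ) : Matrix (Fin n) (Fin M) ℝ :=
  Matrix.of fun _ m => q m

/-- The σ-algebra generated by the estimates up to and including time `t`. -/
abbrev history {n M : ℕ} {Ω : Type*} (Q : ℕ → Ω → Matrix (Fin n) (Fin M) ℝ) (t : ℕ) :
    MeasurableSpace Ω :=
  ⨆ s : Fin (t + 1), MeasurableSpace.comap (fun ω i m => Q s ω i m)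
    (inferInstance : MeasurableSpace (Fin n → Fin M → ℝ))

/-- `Y` is a sequence of social samples drawn from the distributions `P`: the rows `Y_i(t)` are
random messages and, conditionally on the history of the estimates up to time `t`, they are
independent over the agents `i`, with `Y_i(t)` distributed according to `P_i(t)`. -/
structure IsSocialSample {n M : ℕ} {Ω : Type*} [MeasurableSpace Ω] (μ : Measure Ω)
    (Q P Y : ℕ → Ω → Matrix (Fin n) (Fin M) ℝ) : Prop where
  measurable : ∀ t i m, Measurable fun ω => Y t ω i m
  mem_alphabet : ∀ t ω i, Y t ω i ∈ Set.range (msgVec (M := M))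
  law : ∀ (t : ℕ) (v : Fin n → Option (Fin M)),
    μ⟦{ω | ∀ i, Y t ω i = msgVec (v i)} | history Q t⟧ =ᵐ[μ]
      fun ω => ∏ i, msgProb (P t ω i) (v i)

/-- Averaging with social samples: the initial estimates are `Q_i(0) = e_{X_i}`, the messages are
sampled from `P(t) = Q(t)`, and `Q(t+1) = (I - A) Q(t) + W Y(t)`. -/
structure IsAveraging {n M : ℕ} {Ω : Type*} [MeasurableSpace Ω] (μ : Measure Ω)
    (A W : Matrix (Fin n) (Fin n) ℝ) (X : Fin n → Fin M)
    (Q Y : ℕ → Ω → Matrix (Fin n) (Fin M) ℝ) : Prop where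
  init : ∀ ω i, Q 0 ω i = Pi.single (X i) 1
  sample : IsSocialSample μ Q Q Y
  update : ∀ t ω, Q (t + 1) ω = (1 - A) * Q t ω + W * Y t ω

end SocialSampling

end

namespace SocialSampling

/-! The matrix `I - A + W` is row-stochastic and irreducible, so it has a positive stationary vector
`p` (`exists_stationary`). For each column `m`, `∑ p_i Q_{i,m}(t)` is then a bounded martingale with
increments `∑ c_j (Y_{j,m}(t) - Q_{j,m}(t))`, where `c_j = ∑ p_i W_{ij}`. The noises `Y - Q` of
distinct agents are orthogonal, so the second moment grows by exactly `∑ c_j² E(Y_{j,m} - Q_{j,m})²`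
(`integral_stationary_sq`). Boundedness makes these variances summable, hence `Y - Q → 0` almost
surely (`ae_tendsto_noise`).

The rest is pathwise (`exists_consensus_of_tendsto`). The messages asymptotically satisfy `Y(t+1) =
(I - A) Y(t) + W Y(t)`; binary entries leave only finitely many values for the defect, so equality
is eventually exact. An average of binary numbers is binary only if they agree wherever the weight
is positive, so vertices with a common neighbour carry equal labels. Connectedness, with
non-bipartiteness or a lazy agent, makes the labels constant, and then they stay frozen. Row sums
stay 1 almost surely, so exactly one column has limit 1.

Balanced weights preserve `∑_i E Q_{i,m}(t)`; dominated convergence and equality of the limiting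
rows give the mean. -/

/-! ### Deterministic limits of binary message sequences -/

/-- On a connected graph, a binary labelling which agrees on any two vertices with a common
neighbour is constant, as soon as the graph is not bipartite or some vertex has the label of its
neighbours. -/
theorem binary_labelling_constant {V : Type*} {G : SimpleGraph V} (hG : G.Connected)
    {y : V → ℝ} (hy : ∀ i, y i = 0 ∨ y i = 1)
    (hcommon : ∀ i j k, G.Adj i j → G.Adj i k → y j = y k)
    (haper : ¬ G.IsBipartite ∨ ∃ i, ∀ j, G.Adj i j → y i = y j) (i j : V) : y i = y j := by
  by_cases hedge : ∀ u v, G.Adj u v → y u = y v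
  · obtain ⟨p⟩ := hG.preconnected i j
    induction p with
    | nil => rfl
    | cons h _ ih => exact (hedge _ _ h).trans ih
  · exfalso
    push Not at hedge
    obtain ⟨a, b, hab, hne⟩ := hedge
    -- Labels are preserved by two-step walks, so one disagreeing edge spreads along walks until
    -- every edge disagrees; `y` is then a proper 2-colouring.
    have key : ∀ v, ∀ w, G.Adj v w → y w ≠ y v := by
      intro v
      obtain ⟨p⟩ := hG.preconnected v a
      induction p with
      | nil => exact fun w hw h => hne (h ▸ hcommon _ _ _ hw hab)
      | cons h _ ih =>
        rename_i u v' w' p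
        intro w hw hwu
        have h1 : y w = y v' := hcommon _ _ _ hw h
        exact ih hab hne u h.symm (hwu.symm.trans h1)
    rcases haper with hb | ⟨i, hi⟩
    · apply hb
      refine ⟨SimpleGraph.Coloring.mk (fun v => if y v = 1 then (1 : Fin 2) else 0) ?_⟩
      intro v w hvw
      have := key v w hvw
      rcases hy v with h1 | h1 <;> rcases hy w with h2 | h2 <;> simp_all
    -- The walk only serves to produce an edge at `i`; if it is trivial, the edge is `a b`.
    · obtain ⟨p⟩ := hG.preconnected i a
      cases p with
      | nil => exact key _ _ hab (hi _ hab).symm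
      | cons h _ => exact key _ _ h (hi _ h).symm

/-- The averaging map `y ↦ (I - A) y + W y`, with `A` given by its diagonal `a`. -/
noncomputable def averagingStep {n : ℕ} (a : Fin n → ℝ)
    (W : Matrix (Fin n) (Fin n) ℝ) (y : Fin n → ℝ)
    (i : Fin n) : ℝ :=
  (1 - a i) * y i + ∑ j, W i j * y j

theorem averagingStep_const {n : ℕ} {a : Fin n → ℝ} {W : Matrix (Fin n) (Fin n) ℝ}
    (ha_sum : ∀ i, ∑ j, W i j = a i) (b : ℝ) (i : Fin n) :
    averagingStep a W (fun _ => b) i = b := by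
  simp only [averagingStep, ← Finset.sum_mul, ha_sum]
  ring

/-- An average of nonnegative numbers vanishes only if the averaged numbers of positive weight
vanish. -/
theorem averagingStep_eq_zero {n : ℕ} {a : Fin n → ℝ} {W : Matrix (Fin n) (Fin n) ℝ}
    (hW : ∀ i j, 0 ≤ W i j) (ha_le : ∀ i, a i ≤ 1) {y : Fin n → ℝ} (hy : ∀ i, 0 ≤ y i)
    {i : Fin n} (h : averagingStep a W y i = 0) :
    (∀ j, 0 < W i j → y j = 0) ∧ (a i < 1 → y i = 0) := by
  have h1 : 0 ≤ (1 - a i) * y i := mul_nonneg (by linarith [ha_le i]) (hy i)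
  have h2 : ∀ j ∈ Finset.univ, 0 ≤ W i j * y j := fun j _ => mul_nonneg (hW i j) (hy j)
  have h3 := Finset.sum_nonneg h2
  unfold averagingStep at h
  constructor
  · intro j hj
    have h4 := (Finset.sum_eq_zero_iff_of_nonneg h2).1 (by linarith) j (Finset.mem_univ j)
    exact (mul_eq_zero.1 h4).resolve_left hj.ne'
  · intro hi
    have h4 : (1 - a i) * y i = 0 := by linarith
    exact (mul_eq_zero.1 h4).resolve_left (by linarith)

/-- If the average of a binary vector is binary, then it agrees with every entry of positive
weight. -/
theorem averagingStep_binary {n : ℕ} {a : Fin n → ℝ} {W : Matrix (Fin n) (Fin n) ℝ}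
    (hW : ∀ i j, 0 ≤ W i j) (ha_sum : ∀ i, ∑ j, W i j = a i) (ha_le : ∀ i, a i ≤ 1)
    {y : Fin n → ℝ} (hy : ∀ i, y i = 0 ∨ y i = 1) {i : Fin n} {z : ℝ} (hz : z = 0 ∨ z = 1)
    (h : averagingStep a W y i = z) :
    (∀ j, 0 < W i j → y j = z) ∧ (a i < 1 → y i = z) := by
  rcases hz with rfl | rfl
  · exact averagingStep_eq_zero hW ha_le (fun j => by rcases hy j with h | h <;> simp [h]) h
  -- Constants are preserved, so passing to `1 - y` reduces the value 1 to the value 0.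
  · have h' : averagingStep a W (fun j => 1 - y j) i = 0 := by
      have h1 := averagingStep_const ha_sum 1 i
      simp only [averagingStep, mul_sub, Finset.sum_sub_distrib] at h h1 ⊢
      linarith
    have := averagingStep_eq_zero hW ha_le
      (fun j => by rcases hy j with h | h <;> simp [h]) h'
    exact ⟨fun j hj => by linarith [this.1 j hj], fun hi => by linarith [this.2 hi]⟩

/-- A finite set without `b` is closed, so `b` has a neighbourhood missing all other values. -/
theorem eventually_eq_of_tendsto_of_finite {α β : Type*} [TopologicalSpace β] [T1Space β]
    {l : Filter α} {e : α → β} {S : Set β} (hS : S.Finite) (he : ∀ t, e t ∈ S) {b : β}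
    (h : Tendsto e l (𝓝 b)) : ∀ᶠ t in l, e t = b := by
  have hopen : IsOpen (S \ {b})ᶜ := (hS.subset Set.sdiff_subset).isClosed.isOpen_compl
  filter_upwards [h (hopen.mem_nhds (by simp))] with t ht
  by_contra hne
  exact ht ⟨he t, hne⟩

/-- Binary messages that are asymptotically equal to the estimates they are averaged into reach
a consensus. -/
theorem exists_consensus_of_tendsto {n : ℕ} {G : SimpleGraph (Fin n)} (hG : G.Connected)
    {a : Fin n → ℝ} {W : Matrix (Fin n) (Fin n) ℝ}
    (hW : ∀ i j, 0 ≤ W i j) (hW_pos : ∀ i j, 0 < W i j ↔ G.Adj i j)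
    (ha_sum : ∀ i, ∑ j, W i j = a i) (ha_le : ∀ i, a i ≤ 1)
    (haper : ¬ (G.IsBipartite ∧ ∀ i, a i = 1))
    {x y : ℕ → Fin n → ℝ} (hy : ∀ t i, y t i = 0 ∨ y t i = 1)
    (hx : ∀ t i, x (t + 1) i = (1 - a i) * x t i + ∑ j, W i j * y t j)
    (hlim : ∀ i, Tendsto (fun t => y t i - x t i) atTop (𝓝 0)) :
    ∃ b : ℝ, (b = 0 ∨ b = 1) ∧ ∀ i, Tendsto (fun t => x t i) atTop (𝓝 b) := by
  -- The defect equals `(y - x)(t+1) - (1 - a i) (y - x)(t)`, which tends to 0, and it depends only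
  -- on binary data.
  have hstep : ∀ i, ∀ᶠ t in atTop, y (t + 1) i - averagingStep a W (y t) i = 0 := by
    intro i
    have hfin : (Set.pi Set.univ fun _ : Fin n => ({0, 1} : Set ℝ)).Finite :=
      Set.Finite.pi fun _ => Set.toFinite _
    refine eventually_eq_of_tendsto_of_finite
      (Set.Finite.image2 (fun u v => u - averagingStep a W v i) (Set.toFinite {0, 1}) hfin)
      (fun t => ⟨y (t + 1) i, hy _ _, y t, fun j _ => hy _ _, rfl⟩) ?_
    have h1 := ((hlim i).comp (tendsto_add_atTop_nat 1)).sub ((hlim i).const_mul (1 - a i))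
    simp only [mul_zero, sub_zero] at h1
    refine h1.congr fun t => ?_
    simp only [Function.comp_apply, hx, averagingStep]
    ring
  obtain ⟨T, hT⟩ := eventually_atTop.1 (eventually_all.2 hstep)
  have hconst : ∀ t, T ≤ t → ∀ i j, y t i = y t j := by
    intro t ht
    have hb := fun i => averagingStep_binary hW ha_sum ha_le (hy t) (hy (t + 1) i)
      (by linarith [hT t ht i] : averagingStep a W (y t) i = _)
    refine binary_labelling_constant hG (hy t) ?_ ?_
    · intro i j k hij hik
      rw [(hb i).1 j ((hW_pos i j).2 hij), (hb i).1 k ((hW_pos i k).2 hik)]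
    · by_cases hbip : G.IsBipartite
      · right
        have : ∃ i, a i ≠ 1 := by
          by_contra! hcon
          exact haper ⟨hbip, hcon⟩
        obtain ⟨i, hi⟩ := this
        exact ⟨i, fun j hij => by
          rw [(hb i).1 j ((hW_pos i j).2 hij), (hb i).2 (lt_of_le_of_ne (ha_le i) hi)]⟩
      · exact Or.inl hbip
  obtain ⟨i₀⟩ := hG.nonempty
  have hall : ∀ t, T ≤ t → ∀ i, y t i = y T i₀ := by
    intro t ht
    induction t, ht using Nat.le_induction with
    | base => exact fun i => hconst T le_rfl i i₀
    | succ t ht ih =>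
      intro i
      have h1 : y t = fun _ => y T i₀ := funext ih
      have h2 := hT t ht i
      rw [h1, averagingStep_const ha_sum] at h2
      linarith
  refine ⟨y T i₀, hy _ _, fun i => ?_⟩
  have h1 := (hlim i).const_sub (y T i₀)
  rw [sub_zero] at h1
  refine h1.congr' ?_
  filter_upwards [eventually_ge_atTop T] with t ht
  rw [hall t ht i]
  ring

/-- An irreducible averaging matrix has a positive stationary vector. -/
theorem exists_stationary {n : ℕ} {G : SimpleGraph (Fin n)} (hG : G.Connected)
    {a : Fin n → ℝ} {W : Matrix (Fin n) (Fin n) ℝ}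
    (hW : ∀ i j, 0 ≤ W i j) (hW_pos : ∀ i j, 0 < W i j ↔ G.Adj i j)
    (ha_sum : ∀ i, ∑ j, W i j = a i) :
    ∃ p : Fin n → ℝ, (∀ i, 0 < p i) ∧ ∀ j, p j * (1 - a j) + ∑ i, p i * W i j = p j := by
  obtain ⟨i₀⟩ := hG.nonempty
  -- Zero row sums put the constants in the right kernel; singularity then gives a left null vector
  -- `v`, of unknown signs.
  have hdet : (W - Matrix.diagonal a).det = 0 := by
    refine Matrix.exists_mulVec_eq_zero_iff.1 ⟨fun _ => 1, ?_, ?_⟩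
    · exact fun h => one_ne_zero (congrFun h i₀)
    · funext i
      rw [Matrix.sub_mulVec]
      simp [Matrix.mulVec, dotProduct, ha_sum, Matrix.diagonal_apply]
  obtain ⟨v, hv0, hv⟩ := Matrix.exists_vecMul_eq_zero_iff.2 hdet
  have hv' : ∀ j, ∑ i, v i * W i j = v j * a j := by
    intro j
    have := congrFun hv j
    rw [Matrix.vecMul_sub] at this
    simp only [Pi.sub_apply, Matrix.vecMul_diagonal, Pi.zero_apply] at this
    simp only [Matrix.vecMul, dotProduct] at this
    linarith
  have ha_nonneg : ∀ i, 0 ≤ a i := fun i => ha_sum i ▸ Finset.sum_nonneg fun j _ => hW i j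
  have hle : ∀ j ∈ Finset.univ, |v j| * a j ≤ ∑ i, |v i| * W i j := by
    intro j _
    calc |v j| * a j = |∑ i, v i * W i j| := by
          rw [hv', abs_mul, abs_of_nonneg (ha_nonneg j)]
      _ ≤ ∑ i, |v i * W i j| := Finset.abs_sum_le_sum_abs _ _
      _ = ∑ i, |v i| * W i j := by simp only [abs_mul, abs_of_nonneg (hW _ _)]
  -- Both sides of the triangle inequality have the same total, so equality holds for each `j` and
  -- `|v|` is stationary too.
  have hsum : ∑ j, |v j| * a j = ∑ j, ∑ i, |v i| * W i j := by
    rw [Finset.sum_comm]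
    simp only [← Finset.mul_sum, ha_sum]
  have heq := (Finset.sum_eq_sum_iff_of_le hle).1 hsum
  have hpos_of_adj : ∀ i j, G.Adj i j → 0 < |v i| → 0 < |v j| := by
    intro i j hij hi
    have h1 : 0 < ∑ k, |v k| * W k j :=
      Finset.sum_pos' (fun k _ => mul_nonneg (abs_nonneg _) (hW _ _))
        ⟨i, Finset.mem_univ i, mul_pos hi ((hW_pos i j).2 hij)⟩
    rw [← heq j (Finset.mem_univ j)] at h1
    exact pos_of_mul_pos_left h1 (ha_nonneg j)
  obtain ⟨k, hk⟩ := Function.ne_iff.1 hv0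
  refine ⟨fun i => |v i|, fun i => ?_, fun j => ?_⟩
  · obtain ⟨w⟩ := hG.preconnected k i
    have hk' : 0 < |v k| := abs_pos.2 hk
    clear hk
    induction w with
    | nil => exact hk'
    | cons h _ ih => exact ih (hpos_of_adj _ _ h hk')
  · have := heq j (Finset.mem_univ j)
    linarith

/-! ### Messages -/

theorem msgVec_injective {M : ℕ} : Function.Injective (msgVec (M := M)) := by
  intro v w h
  match v, w, h with
  | none, none, _ => rfl
  | none, some m, h => simpa [msgVec] using congrFun h m
  | some m, none, h => simpa [msgVec] using congrFun h m
  | some m, some k, h =>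
    have := congrFun h m
    simp only [msgVec, Pi.single_eq_same] at this
    by_contra hne
    rw [Pi.single_eq_of_ne (fun hmk => hne (by rw [hmk]))] at this
    exact one_ne_zero this

theorem msgVec_binary {M : ℕ} (v : Option (Fin M)) (m : Fin M) :
    msgVec v m = 0 ∨ msgVec v m = 1 := by
  cases v with
  | none => simp [msgVec]
  | some k => by_cases h : m = k <;> simp [msgVec, h]

theorem sum_msgVec_le_one {M : ℕ} (v : Option (Fin M)) : ∑ m, msgVec v m ≤ 1 := by
  cases v <;> simp [msgVec]

theorem sum_msgProb {M : ℕ} (p : Fin M → ℝ) : ∑ o, msgProb p o = 1 := by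
  simp [Fintype.sum_option, msgProb]

theorem sum_msgProb_mul_msgVec {M : ℕ} (p : Fin M → ℝ) (m : Fin M) :
    ∑ o, msgProb p o * msgVec o m = p m := by
  simp [Fintype.sum_option, msgProb, msgVec, Pi.single_apply]

/-! ### Conditional moments of the messages -/

section Sample

variable {n M : ℕ} {Ω : Type*} [MeasurableSpace Ω] {μ : Measure Ω}
  {Q P Y : ℕ → Ω → Matrix (Fin n) (Fin M) ℝ}

theorem IsSocialSample.binary (h : IsSocialSample μ Q P Y) (t : ℕ) (ω : Ω) (i : Fin n)
    (m : Fin M) : Y t ω i m = 0 ∨ Y t ω i m = 1 := by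
  obtain ⟨v, hv⟩ := h.mem_alphabet t ω i
  rw [← hv]
  exact msgVec_binary v m

theorem IsSocialSample.sum_le_one (h : IsSocialSample μ Q P Y) (t : ℕ) (ω : Ω) (i : Fin n) :
    ∑ m, Y t ω i m ≤ 1 := by
  obtain ⟨v, hv⟩ := h.mem_alphabet t ω i
  rw [← hv]
  exact sum_msgVec_le_one v

theorem IsSocialSample.measurableSet_eq (h : IsSocialSample μ Q P Y) (t : ℕ)
    (v : Fin n → Option (Fin M)) : MeasurableSet {ω | ∀ i, Y t ω i = msgVec (v i)} := by
  have : {ω | ∀ i, Y t ω i = msgVec (v i)} = ⋂ i, ⋂ m, {ω | Y t ω i m = msgVec (v i) m} := by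
    ext ω
    simp only [Set.mem_iInter, Set.mem_ofPred_eq, funext_iff]
  rw [this]
  exact MeasurableSet.iInter fun i => MeasurableSet.iInter fun m =>
    h.measurable t i m (measurableSet_singleton _)

/-- The conditional expectation of a product over the agents of functions of their messages. -/
theorem IsSocialSample.condExp_prod [IsProbabilityMeasure μ] (h : IsSocialSample μ Q P Y) (t : ℕ)
    (g : Fin n → (Fin M → ℝ) → ℝ) :
    μ[fun ω => ∏ i, g i (Y t ω i) | history Q t] =ᵐ[μ]
      fun ω => ∏ i, ∑ o, msgProb (P t ω i) o * g i (msgVec o) := by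
  classical
  set S : (Fin n → Option (Fin M)) → Set Ω := fun v => {ω | ∀ i, Y t ω i = msgVec (v i)}
  have hS : ∀ v ω, ω ∈ S v ↔ ∀ i, Y t ω i = msgVec (v i) := fun _ _ => Iff.rfl
  -- The alphabet is finite: the product is a combination of indicators of the disjoint message
  -- configurations, whose conditional probabilities are given by `law`.
  have hsum : (fun ω => ∏ i, g i (Y t ω i)) =
      ∑ v : Fin n → Option (Fin M),
        (∏ i, g i (msgVec (v i))) • (S v).indicator (fun _ => (1 : ℝ)) := by
    funext ω
    choose v hv using fun i => h.mem_alphabet t ω i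
    rw [Finset.sum_apply, Finset.sum_eq_single v]
    · rw [Pi.smul_apply, Set.indicator_of_mem ((hS v ω).2 fun i => (hv i).symm)]
      simp [hv]
    · intro w _ hw
      rw [Pi.smul_apply, Set.indicator_of_notMem, smul_zero]
      intro hmem
      exact hw (funext fun i => msgVec_injective (((hS w ω).1 hmem i).symm.trans (hv i).symm))
    · simp
  rw [hsum]
  have hint : ∀ v, Integrable ((S v).indicator (fun _ => (1 : ℝ))) μ := fun v =>
    (integrable_const 1).indicator (h.measurableSet_eq t v)
  refine (condExp_finsetSum (fun v _ => (hint v).smul _) _).trans ?_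
  have hall : ∀ᵐ ω ∂μ, ∀ v : Fin n → Option (Fin M),
      (μ[(∏ i, g i (msgVec (v i))) • (S v).indicator (fun _ => (1 : ℝ)) | history Q t]) ω =
        (∏ i, g i (msgVec (v i))) * ∏ i, msgProb (P t ω i) (v i) := by
    rw [ae_all_iff]
    intro v
    filter_upwards [condExp_smul (μ := μ) (∏ i, g i (msgVec (v i)))
      ((S v).indicator (fun _ => (1 : ℝ))) (history Q t), h.law t v] with ω h1 h2
    rw [h1, Pi.smul_apply, smul_eq_mul]
    exact congrArg _ h2
  filter_upwards [hall] with ω hω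
  rw [Finset.sum_apply, Finset.prod_univ_sum, Fintype.piFinset_univ]
  refine Finset.sum_congr rfl fun v _ => ?_
  rw [hω, Finset.prod_mul_distrib, mul_comm]

/-- The conditional expectation of a product of indicators that distinct agents send `m`. -/
theorem IsSocialSample.condExp_prod_apply [IsProbabilityMeasure μ] (h : IsSocialSample μ Q P Y)
    (t : ℕ) (m : Fin M) (s : Finset (Fin n)) :
    μ[fun ω => ∏ i ∈ s, Y t ω i m | history Q t] =ᵐ[μ] fun ω => ∏ i ∈ s, P t ω i m := by
  classical
  -- Agents outside `s` get the factor 1, which integrates to the total mass of their message law.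
  have := h.condExp_prod t (fun i y => if i ∈ s then y m else 1)
  simp only [Finset.prod_ite_mem, Finset.univ_inter] at this
  refine this.trans (Eventually.of_forall fun ω => ?_)
  dsimp only
  conv_rhs => rw [← Finset.univ_inter s, ← Finset.prod_ite_mem]
  refine Finset.prod_congr rfl fun i _ => ?_
  split_ifs
  · exact sum_msgProb_mul_msgVec _ _
  · simpa using sum_msgProb (P t ω i)

end Sample

/-! ### Integrability and almost sure convergence -/

theorem integrable_of_mem_unitInterval {Ω : Type*} [MeasurableSpace Ω] {μ : Measure Ω}
    [IsFiniteMeasure μ] {f : Ω → ℝ} (hf : Measurable f) (h : ∀ ω, 0 ≤ f ω ∧ f ω ≤ 1) :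
    Integrable f μ :=
  Integrable.of_bound hf.aestronglyMeasurable 1 (Eventually.of_forall fun ω => by
    rw [Real.norm_eq_abs, abs_of_nonneg (h ω).1]
    exact (h ω).2)

theorem integrable_mul_of_abs_le_one {Ω : Type*} [MeasurableSpace Ω] {μ : Measure Ω} [IsFiniteMeasure μ]
    {f g : Ω → ℝ} (hf : Measurable f) (hg : Measurable g)
    (hf1 : ∀ ω, |f ω| ≤ 1) (hg1 : ∀ ω, |g ω| ≤ 1) : Integrable (fun ω => f ω * g ω) μ :=
  Integrable.of_bound (hf.mul hg).aestronglyMeasurable 1 (Eventually.of_forall fun ω => by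
    rw [Real.norm_eq_abs, abs_mul]
    exact mul_le_one₀ (hf1 ω) (abs_nonneg _) (hg1 ω))

/-- By Tonelli the sum of the series has finite mean, so it is finite almost surely and its terms
vanish in the limit. -/
theorem ae_tendsto_zero_of_summable_integral {Ω : Type*} [MeasurableSpace Ω] {μ : Measure Ω}
    {f : ℕ → Ω → ℝ} (hf : ∀ t, Integrable (f t) μ) (hmeas : ∀ t, Measurable (f t))
    (hnonneg : ∀ t ω, 0 ≤ f t ω)
    (hsum : Summable fun t => ∫ ω, f t ω ∂μ) :
    ∀ᵐ ω ∂μ, Tendsto (fun t => f t ω) atTop (𝓝 0) := by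
  have h1 : ∫⁻ ω, ∑' t, ENNReal.ofReal (f t ω) ∂μ ≠ ⊤ := by
    rw [lintegral_tsum fun t => (hmeas t).ennreal_ofReal.aemeasurable]
    simp only [← ofReal_integral_eq_lintegral_ofReal (hf _) (Eventually.of_forall (hnonneg _))]
    exact hsum.tsum_ofReal_ne_top
  filter_upwards [ae_lt_top (.tsum fun t => (hmeas t).ennreal_ofReal) h1] with ω hω
  have h2 := ENNReal.tendsto_atTop_zero_of_tsum_ne_top hω.ne
  have h3 := (ENNReal.tendsto_toReal ENNReal.zero_ne_top).comp h2
  simpa [Function.comp_def, ENNReal.toReal_ofReal, hnonneg] using h3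

/-! ### Pathwise bounds and measurability of the estimates -/

/-- `W` is a nonnegative matrix whose row sums form the diagonal matrix `A ≤ I`. -/
structure IsWeighting {n : ℕ} (A W : Matrix (Fin n) (Fin n) ℝ) : Prop where
  nonneg : ∀ i j, 0 ≤ W i j
  isDiag : A.IsDiag
  sum_eq : ∀ i, ∑ j, W i j = A i i
  le_one : ∀ i, A i i ≤ 1

namespace IsAveraging

variable {n M : ℕ} {Ω : Type*} [MeasurableSpace Ω] {μ : Measure Ω}
  {A W : Matrix (Fin n) (Fin n) ℝ} {X : Fin n → Fin M}
  {Q Y : ℕ → Ω → Matrix (Fin n) (Fin M) ℝ}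

theorem update_apply (h : IsAveraging μ A W X Q Y) (hA : A.IsDiag) (t : ℕ) (ω : Ω) (i : Fin n)
    (m : Fin M) :
    Q (t + 1) ω i m = (1 - A i i) * Q t ω i m + ∑ j, W i j * Y t ω j m := by
  rw [h.update, ← hA.diagonal_diag, Matrix.sub_mul, Matrix.one_mul, Matrix.add_apply,
    Matrix.sub_apply, Matrix.diagonal_mul, Matrix.mul_apply, Matrix.diagonal_apply_eq]
  ring

theorem sum_update (h : IsAveraging μ A W X Q Y) (hA : A.IsDiag) (t : ℕ) (ω : Ω) (i : Fin n) :
    ∑ m, Q (t + 1) ω i m =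
      (1 - A i i) * ∑ m, Q t ω i m + ∑ j, W i j * ∑ m, Y t ω j m := by
  simp only [h.update_apply hA, Finset.sum_add_distrib, Finset.mul_sum]
  rw [Finset.sum_comm]

theorem sum_init (h : IsAveraging μ A W X Q Y) (ω : Ω) (i : Fin n) : ∑ m, Q 0 ω i m = 1 := by
  rw [h.init]
  simp

theorem nonneg (h : IsAveraging μ A W X Q Y) (hw : IsWeighting A W) (t : ℕ) (ω : Ω) (i : Fin n)
    (m : Fin M) : 0 ≤ Q t ω i m := by
  induction t generalizing i with
  | zero => rw [h.init]; by_cases hm : m = X i <;> simp [hm]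
  | succ t ih =>
    rw [h.update_apply hw.isDiag]
    refine add_nonneg (mul_nonneg (by linarith [hw.le_one i]) (ih i))
      (Finset.sum_nonneg fun j _ => mul_nonneg (hw.nonneg i j) ?_)
    rcases h.sample.binary t ω j m with h | h <;> simp [h]

/-- Only an inequality holds surely, since a silent message loses mass; equality is recovered almost
surely in `ae_sum_eq_one`. -/
theorem sum_le_one (h : IsAveraging μ A W X Q Y) (hw : IsWeighting A W) (t : ℕ) (ω : Ω)
    (i : Fin n) : ∑ m, Q t ω i m ≤ 1 := by
  induction t generalizing i with
  | zero => exact (h.sum_init ω i).le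
  | succ t ih =>
    rw [h.sum_update hw.isDiag]
    have h1 : (1 - A i i) * ∑ m, Q t ω i m ≤ (1 - A i i) * 1 :=
      mul_le_mul_of_nonneg_left (ih i) (by linarith [hw.le_one i])
    have h2 : ∑ j, W i j * ∑ m, Y t ω j m ≤ ∑ j, W i j * 1 :=
      Finset.sum_le_sum fun j _ =>
        mul_le_mul_of_nonneg_left (h.sample.sum_le_one t ω j) (hw.nonneg i j)
    simp only [mul_one, hw.sum_eq] at h1 h2
    linarith

theorem mem_unitInterval (h : IsAveraging μ A W X Q Y) (hw : IsWeighting A W) (t : ℕ) (ω : Ω)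
    (i : Fin n) (m : Fin M) : 0 ≤ Q t ω i m ∧ Q t ω i m ≤ 1 :=
  ⟨h.nonneg hw t ω i m, (Finset.single_le_sum (f := fun m => Q t ω i m)
    (fun k _ => h.nonneg hw t ω i k) (Finset.mem_univ m)).trans (h.sum_le_one hw t ω i)⟩

theorem message_mem_unitInterval (h : IsAveraging μ A W X Q Y) (t : ℕ) (ω : Ω)
    (i : Fin n) (m : Fin M) : 0 ≤ Y t ω i m ∧ Y t ω i m ≤ 1 := by
  rcases h.sample.binary t ω i m with h | h <;> simp [h]

/-- The start is deterministic and the recursion involves only the messages, whose measurability is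
assumed. -/
theorem measurable (h : IsAveraging μ A W X Q Y) (hA : A.IsDiag) (t : ℕ) (i : Fin n)
    (m : Fin M) : Measurable fun ω => Q t ω i m := by
  induction t generalizing i with
  | zero => simp only [h.init]; exact measurable_const
  | succ t ih =>
    simp only [h.update_apply hA]
    exact ((ih i).const_mul _).add
      (Finset.measurable_fun_sum _ fun j _ => (h.sample.measurable t j m).const_mul _)

theorem history_le (h : IsAveraging μ A W X Q Y) (hA : A.IsDiag) (t : ℕ) :
    history Q t ≤ (inferInstance : MeasurableSpace Ω) :=
  iSup_le fun s => Measurable.comap_le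
    (measurable_pi_iff.2 fun i => measurable_pi_iff.2 fun m => h.measurable hA s i m)

theorem abs_le_one (h : IsAveraging μ A W X Q Y) (hw : IsWeighting A W) (t : ℕ) (ω : Ω)
    (i : Fin n) (m : Fin M) : |Q t ω i m| ≤ 1 := by
  have := h.mem_unitInterval hw t ω i m
  exact abs_le.2 ⟨by linarith, by linarith⟩

theorem abs_noise_le_one (h : IsAveraging μ A W X Q Y) (hw : IsWeighting A W) (t : ℕ) (ω : Ω)
    (i : Fin n) (m : Fin M) : |Y t ω i m - Q t ω i m| ≤ 1 := by
  have h1 := h.mem_unitInterval hw t ω i m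
  have h2 := h.message_mem_unitInterval t ω i m
  exact abs_le.2 ⟨by linarith, by linarith⟩

theorem measurable_noise (h : IsAveraging μ A W X Q Y) (hA : A.IsDiag) (t : ℕ) (i : Fin n)
    (m : Fin M) : Measurable fun ω => Y t ω i m - Q t ω i m :=
  (h.sample.measurable t i m).sub (h.measurable hA t i m)

end IsAveraging

/-- This allows current estimates to be pulled out of conditional expectations. -/
theorem measurable_history {n M : ℕ} {Ω : Type*} (Q : ℕ → Ω → Matrix (Fin n) (Fin M) ℝ)
    (t : ℕ) (i : Fin n) (m : Fin M) : Measurable[history Q t] fun ω => Q t ω i m := by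
  have h1 : Measurable[MeasurableSpace.comap (fun ω i m => Q t ω i m)
      (inferInstance : MeasurableSpace (Fin n → Fin M → ℝ))] fun ω i m => Q t ω i m :=
    comap_measurable _
  have h2 : Measurable fun q : Fin n → Fin M → ℝ => q i m := by fun_prop
  exact (h2.comp h1).mono (le_iSup (fun s : Fin (t + 1) => MeasurableSpace.comap
    (fun ω i m => Q s ω i m) (inferInstance : MeasurableSpace (Fin n → Fin M → ℝ)))
    (Fin.last t)) le_rfl

/-! ### Orthogonality of the noise and growth of second moments -/

namespace IsAveraging

variable {n M : ℕ} {Ω : Type*} [MeasurableSpace Ω] {μ : Measure Ω} [IsProbabilityMeasure μ]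
  {A W : Matrix (Fin n) (Fin n) ℝ} {X : Fin n → Fin M}
  {Q Y : ℕ → Ω → Matrix (Fin n) (Fin M) ℝ}

theorem integrable (h : IsAveraging μ A W X Q Y) (hw : IsWeighting A W) (t : ℕ) (i : Fin n)
    (m : Fin M) : Integrable (fun ω => Q t ω i m) μ :=
  integrable_of_mem_unitInterval (h.measurable hw.isDiag t i m)
    fun ω => h.mem_unitInterval hw t ω i m

theorem integrable_message (h : IsAveraging μ A W X Q Y) (t : ℕ) (i : Fin n)
    (m : Fin M) : Integrable (fun ω => Y t ω i m) μ :=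
  integrable_of_mem_unitInterval (h.sample.measurable t i m)
    fun ω => h.message_mem_unitInterval t ω i m

/-- Messages have the mean of the estimates. -/
theorem integral_message (h : IsAveraging μ A W X Q Y) (hw : IsWeighting A W) (t : ℕ) (i : Fin n)
    (m : Fin M) : ∫ ω, Y t ω i m ∂μ = ∫ ω, Q t ω i m ∂μ := by
  have h1 := h.sample.condExp_prod_apply t m {i}
  simp only [Finset.prod_singleton] at h1
  rw [← integral_condExp (h.history_le hw.isDiag t)]
  exact integral_congr_ae h1

theorem integral_message_mul_message (h : IsAveraging μ A W X Q Y) (hw : IsWeighting A W)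
    (t : ℕ) {i j : Fin n} (hij : i ≠ j) (m : Fin M) :
    ∫ ω, Y t ω i m * Y t ω j m ∂μ = ∫ ω, Q t ω i m * Q t ω j m ∂μ := by
  have h1 := h.sample.condExp_prod_apply t m {i, j}
  simp only [Finset.prod_pair hij] at h1
  rw [← integral_condExp (h.history_le hw.isDiag t)]
  exact integral_congr_ae h1

theorem integral_mul_message (h : IsAveraging μ A W X Q Y) (hw : IsWeighting A W)
    (t : ℕ) (i j : Fin n) (m : Fin M) :
    ∫ ω, Q t ω i m * Y t ω j m ∂μ = ∫ ω, Q t ω i m * Q t ω j m ∂μ := by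
  have h1 := h.sample.condExp_prod_apply t m {j}
  simp only [Finset.prod_singleton] at h1
  rw [← integral_condExp (h.history_le hw.isDiag t)]
  refine integral_congr_ae ((condExp_mul_of_stronglyMeasurable_left
    (measurable_history Q t i m).stronglyMeasurable ?_ (h.integrable_message t j m)).trans ?_)
  · refine integrable_of_mem_unitInterval
      ((h.measurable hw.isDiag t i m).mul (h.sample.measurable t j m)) fun ω => ?_
    have h2 := h.mem_unitInterval hw t ω i m
    have h3 := h.message_mem_unitInterval t ω j m
    exact ⟨mul_nonneg h2.1 h3.1, mul_le_one₀ h2.2 h3.1 h3.2⟩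
  · filter_upwards [h1] with ω hω
    simp only [Pi.mul_apply, hω]

/-- The noise has conditional mean zero given the history, hence is orthogonal to every current
estimate, including the case `i = j`. -/
theorem integral_mul_noise (h : IsAveraging μ A W X Q Y) (hw : IsWeighting A W)
    (t : ℕ) (i j : Fin n) (m : Fin M) :
    ∫ ω, Q t ω i m * (Y t ω j m - Q t ω j m) ∂μ = 0 := by
  have hA := hw.isDiag
  have hYabs : ∀ ω k, |Y t ω k m| ≤ 1 := fun ω k => by
    have := h.message_mem_unitInterval t ω k m
    exact abs_le.2 ⟨by linarith, by linarith⟩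
  simp only [mul_sub]
  rw [integral_sub, h.integral_mul_message hw, sub_self]
  · exact integrable_mul_of_abs_le_one (h.measurable hA t i m) (h.sample.measurable t j m)
      (fun ω => h.abs_le_one hw t ω i m) (fun ω => hYabs ω j)
  · exact integrable_mul_of_abs_le_one (h.measurable hA t i m) (h.measurable hA t j m)
      (fun ω => h.abs_le_one hw t ω i m) (fun ω => h.abs_le_one hw t ω j m)

/-- Conditional independence enters here, through the mixed moment of two distinct messages. -/
theorem integral_noise_mul_noise (h : IsAveraging μ A W X Q Y) (hw : IsWeighting A W)
    (t : ℕ) {i j : Fin n} (hij : i ≠ j) (m : Fin M) :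
    ∫ ω, (Y t ω i m - Q t ω i m) * (Y t ω j m - Q t ω j m) ∂μ = 0 := by
  have hA := hw.isDiag
  have hYabs : ∀ ω k, |Y t ω k m| ≤ 1 := fun ω k => by
    have := h.message_mem_unitInterval t ω k m
    exact abs_le.2 ⟨by linarith, by linarith⟩
  have h1 : ∀ ω, (Y t ω i m - Q t ω i m) * (Y t ω j m - Q t ω j m) =
      Y t ω i m * Y t ω j m - Q t ω j m * Y t ω i m - Q t ω i m * (Y t ω j m - Q t ω j m) :=
    fun ω => by ring
  have hYY := integrable_mul_of_abs_le_one (μ := μ) (h.sample.measurable t i m) (h.sample.measurable t j m)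
    (fun ω => hYabs ω i) (fun ω => hYabs ω j)
  have hQY := integrable_mul_of_abs_le_one (μ := μ) (h.measurable hA t j m) (h.sample.measurable t i m)
    (fun ω => h.abs_le_one hw t ω j m) (fun ω => hYabs ω i)
  have hQD := integrable_mul_of_abs_le_one (μ := μ) (h.measurable hA t i m) (h.measurable_noise hA t j m)
    (fun ω => h.abs_le_one hw t ω i m) (fun ω => h.abs_noise_le_one hw t ω j m)
  have hYQ : Integrable (fun ω => Y t ω i m * Y t ω j m - Q t ω j m * Y t ω i m) μ := hYY.sub hQY
  simp only [h1]
  rw [integral_sub hYQ hQD, integral_sub hYY hQY, h.integral_mul_noise hw,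
    h.integral_message_mul_message hw t hij, h.integral_mul_message hw]
  simp only [mul_comm, sub_self]

/-- The second moment of the estimates averaged against a stationary vector increases by the
weighted variance of the messages. -/
theorem integral_stationary_sq (h : IsAveraging μ A W X Q Y) (hw : IsWeighting A W)
    {p : Fin n → ℝ} (hp : ∀ j, p j * (1 - A j j) + ∑ i, p i * W i j = p j) (t : ℕ) (m : Fin M) :
    ∫ ω, (∑ i, p i * Q (t + 1) ω i m) ^ 2 ∂μ = ∫ ω, (∑ i, p i * Q t ω i m) ^ 2 ∂μ +
      ∑ j, (∑ i, p i * W i j) ^ 2 * ∫ ω, (Y t ω j m - Q t ω j m) ^ 2 ∂μ := by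
  have hA := hw.isDiag
  set c : Fin n → ℝ := fun j => ∑ i, p i * W i j with hc
  -- Stationarity reads `p i * (1 - A i i) = p i - c i`, which turns the update into a martingale
  -- increment.
  have hstep : ∀ ω, ∑ i, p i * Q (t + 1) ω i m =
      ∑ i, p i * Q t ω i m + ∑ j, c j * (Y t ω j m - Q t ω j m) := by
    intro ω
    have h1 : ∑ i, p i * ∑ j, W i j * Y t ω j m = ∑ j, c j * Y t ω j m := by
      simp only [Finset.mul_sum, hc, Finset.sum_mul]
      rw [Finset.sum_comm]
      simp only [mul_assoc]
    simp only [h.update_apply hA, mul_add, Finset.sum_add_distrib, h1, mul_sub,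
      Finset.sum_sub_distrib]
    have h2 : ∑ i, p i * ((1 - A i i) * Q t ω i m) =
        ∑ i, p i * Q t ω i m - ∑ i, c i * Q t ω i m := by
      rw [← Finset.sum_sub_distrib]
      refine Finset.sum_congr rfl fun i _ => ?_
      rw [← sub_mul, ← mul_assoc]
      congr 1
      exact eq_sub_of_add_eq (hp i)
    simp only [mul_sub, sub_mul, one_mul] at h2 ⊢
    linarith
  have hexp : ∀ ω, (∑ i, p i * Q (t + 1) ω i m) ^ 2 = (∑ i, p i * Q t ω i m) ^ 2 +
      ∑ i, ∑ j, (2 * p i * c j) * (Q t ω i m * (Y t ω j m - Q t ω j m)) +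
      ∑ i, ∑ j, (c i * c j) * ((Y t ω i m - Q t ω i m) * (Y t ω j m - Q t ω j m)) := by
    intro ω
    rw [hstep, add_sq, sq (∑ j, c j * (Y t ω j m - Q t ω j m)), mul_assoc,
      Finset.sum_mul_sum, Finset.sum_mul_sum, Finset.mul_sum]
    simp only [Finset.mul_sum]
    refine congrArg₂ _ (congrArg₂ _ rfl ?_) ?_ <;>
    exact Finset.sum_congr rfl fun i _ => Finset.sum_congr rfl fun j _ => by ring
  have hi1 : Integrable (fun ω => (∑ i, p i * Q t ω i m) ^ 2) μ := by
    simp only [sq, Finset.sum_mul_sum]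
    refine integrable_finsetSum _ fun i _ => integrable_finsetSum _ fun j _ => ?_
    refine ((integrable_mul_of_abs_le_one (h.measurable hA t i m) (h.measurable hA t j m)
      (fun ω => h.abs_le_one hw t ω i m) (fun ω => h.abs_le_one hw t ω j m)).const_mul
      (p i * p j)).congr (Eventually.of_forall fun ω => ?_)
    dsimp only
    ring
  have hi2 : ∀ i j, Integrable
      (fun ω => (2 * p i * c j) * (Q t ω i m * (Y t ω j m - Q t ω j m))) μ := fun i j =>
    (integrable_mul_of_abs_le_one (h.measurable hA t i m) (h.measurable_noise hA t j m)
      (fun ω => h.abs_le_one hw t ω i m) (fun ω => h.abs_noise_le_one hw t ω j m)).const_mul _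
  have hi3 : ∀ i j, Integrable
      (fun ω => (c i * c j) * ((Y t ω i m - Q t ω i m) * (Y t ω j m - Q t ω j m))) μ := fun i j =>
    (integrable_mul_of_abs_le_one (h.measurable_noise hA t i m) (h.measurable_noise hA t j m)
      (fun ω => h.abs_noise_le_one hw t ω i m)
      (fun ω => h.abs_noise_le_one hw t ω j m)).const_mul _
  have hi2' := fun i => integrable_finsetSum Finset.univ fun j _ => hi2 i j
  have hi3' := fun i => integrable_finsetSum Finset.univ fun j _ => hi3 i j
  have hi2'' := integrable_finsetSum Finset.univ fun i _ => hi2' i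
  have hi3'' := integrable_finsetSum Finset.univ fun i _ => hi3' i
  have hi12 : Integrable (fun ω => (∑ i, p i * Q t ω i m) ^ 2 +
      ∑ i, ∑ j, (2 * p i * c j) * (Q t ω i m * (Y t ω j m - Q t ω j m))) μ := hi1.add hi2''
  simp only [hexp]
  rw [integral_add hi12 hi3'', integral_add hi1 hi2'',
    integral_finsetSum _ fun i _ => hi2' i, integral_finsetSum _ fun i _ => hi3' i]
  simp only [integral_finsetSum _ fun j _ => hi2 _ j, integral_finsetSum _ fun j _ => hi3 _ j,
    integral_const_mul, h.integral_mul_noise hw, mul_zero, Finset.sum_const_zero, add_zero]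
  congr 1
  refine Finset.sum_congr rfl fun i _ => ?_
  rw [Finset.sum_eq_single i]
  · simp only [sq, hc]
  · intro j _ hji
    rw [h.integral_noise_mul_noise hw t hji.symm, mul_zero]
  · simp

end IsAveraging

/-! ### Vanishing noise and almost sure consensus -/

namespace IsAveraging

variable {n M : ℕ} {Ω : Type*} [MeasurableSpace Ω] {μ : Measure Ω} [IsProbabilityMeasure μ]
  {A W : Matrix (Fin n) (Fin n) ℝ} {X : Fin n → Fin M}
  {Q Y : ℕ → Ω → Matrix (Fin n) (Fin M) ℝ}

/-- The noise of every message that is listened to is square summable. -/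
theorem summable_noise (h : IsAveraging μ A W X Q Y) (hw : IsWeighting A W)
    {p : Fin n → ℝ} (hp0 : ∀ i, 0 ≤ p i)
    (hp : ∀ j, p j * (1 - A j j) + ∑ i, p i * W i j = p j)
    {j : Fin n} (hj : ∑ i, p i * W i j ≠ 0) (m : Fin M) :
    Summable fun t => ∫ ω, (Y t ω j m - Q t ω j m) ^ 2 ∂μ := by
  have he : ∀ t k, 0 ≤ (∑ i, p i * W i k) ^ 2 * ∫ ω, (Y t ω k m - Q t ω k m) ^ 2 ∂μ :=
    fun t k => mul_nonneg (sq_nonneg _) (integral_nonneg fun ω => sq_nonneg _)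
  have hV : ∀ t, ∫ ω, (∑ i, p i * Q t ω i m) ^ 2 ∂μ ≤ (∑ i, p i) ^ 2 := by
    intro t
    have hle : ∀ ω, (∑ i, p i * Q t ω i m) ^ 2 ≤ (∑ i, p i) ^ 2 := fun ω => by
      refine pow_le_pow_left₀ (Finset.sum_nonneg fun i _ => mul_nonneg (hp0 i)
        (h.nonneg hw t ω i m)) (Finset.sum_le_sum fun i _ => ?_) 2
      exact mul_le_of_le_one_right (hp0 i) (h.mem_unitInterval hw t ω i m).2
    have := integral_mono_of_nonneg (μ := μ) (Eventually.of_forall fun ω => sq_nonneg _)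
      (integrable_const ((∑ i, p i) ^ 2)) (Eventually.of_forall hle)
    simpa using this
  -- The second-moment increments telescope; only the term of agent `j` is kept.
  have hsum : ∀ t, ∑ s ∈ Finset.range t,
      (∑ i, p i * W i j) ^ 2 * ∫ ω, (Y s ω j m - Q s ω j m) ^ 2 ∂μ ≤
        ∫ ω, (∑ i, p i * Q t ω i m) ^ 2 ∂μ := by
    intro t
    induction t with
    | zero => simpa using integral_nonneg fun ω => sq_nonneg _
    | succ t ih =>
      rw [Finset.sum_range_succ, h.integral_stationary_sq hw hp]
      exact add_le_add ih (Finset.single_le_sum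
        (f := fun k => (∑ i, p i * W i k) ^ 2 * ∫ ω, (Y t ω k m - Q t ω k m) ^ 2 ∂μ)
        (fun k _ => he t k) (Finset.mem_univ j))
  have h1 := summable_of_sum_range_le (fun t => he t j) fun t => (hsum t).trans (hV t)
  exact (summable_mul_left_iff (pow_ne_zero 2 hj)).1 h1

/-- The messages of an agent whose estimate stays at its initial value are noiseless. -/
theorem integral_noise_sq_eq_zero (h : IsAveraging μ A W X Q Y) (hw : IsWeighting A W)
    {j : Fin n} {t : ℕ} (hj : ∀ ω, Q t ω j = Q 0 ω j) (m : Fin M) :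
    ∫ ω, (Y t ω j m - Q t ω j m) ^ 2 ∂μ = 0 := by
  -- The identity uses that `Y` and `Q` are both binary here; each term on the right has mean zero.
  have h1 : ∀ ω, (Y t ω j m - Q t ω j m) ^ 2 =
      (Y t ω j m - Q t ω j m) - 2 * (Q t ω j m * (Y t ω j m - Q t ω j m)) := by
    intro ω
    have hQ : Q t ω j m = 0 ∨ Q t ω j m = 1 := by
      rw [hj, h.init]
      by_cases hm : m = X j <;> simp [hm]
    rcases h.sample.binary t ω j m with h1 | h1 <;> rcases hQ with h2 | h2 <;>
      rw [h1, h2] <;> norm_num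
  have hD : Integrable (fun ω => Y t ω j m - Q t ω j m) μ :=
    (h.integrable_message t j m).sub (h.integrable hw t j m)
  simp only [h1]
  rw [integral_sub hD ((integrable_mul_of_abs_le_one (h.measurable hw.isDiag t j m)
      (h.measurable_noise hw.isDiag t j m) (fun ω => h.abs_le_one hw t ω j m)
      (fun ω => h.abs_noise_le_one hw t ω j m)).const_mul 2),
    integral_sub (h.integrable_message t j m) (h.integrable hw t j m),
    h.integral_message hw, integral_const_mul, h.integral_mul_noise hw]
  simp

theorem ae_tendsto_noise (h : IsAveraging μ A W X Q Y) (hw : IsWeighting A W)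
    {G : SimpleGraph (Fin n)} (hG : G.Connected) (hW_pos : ∀ i j, 0 < W i j ↔ G.Adj i j) :
    ∀ᵐ ω ∂μ, ∀ j m, Tendsto (fun t => Y t ω j m - Q t ω j m) atTop (𝓝 0) := by
  obtain ⟨p, hp0, hp⟩ := exists_stationary hG hw.nonneg hW_pos hw.sum_eq
  rw [ae_all_iff]
  intro j
  rw [ae_all_iff]
  intro m
  have hsum : Summable fun t => ∫ ω, (Y t ω j m - Q t ω j m) ^ 2 ∂μ := by
    -- A zero coefficient means that nobody listens to `j`. As the support of `W` is symmetric, `j`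
    -- is isolated and its estimate never moves.
    by_cases hj : ∑ i, p i * W i j = 0
    · have hcol : ∀ i, W i j = 0 := fun i => by
        have := (Finset.sum_eq_zero_iff_of_nonneg fun i _ =>
          mul_nonneg (hp0 i).le (hw.nonneg i j)).1 hj i (Finset.mem_univ i)
        exact (mul_eq_zero.1 this).resolve_left (hp0 i).ne'
      have hrow : ∀ i, W j i = 0 := fun i => by
        by_contra hne
        have h1 := (hW_pos j i).1 (lt_of_le_of_ne (hw.nonneg j i) (Ne.symm hne))
        exact ((hW_pos i j).2 h1.symm).ne' (hcol i)
      have hconst : ∀ t ω, Q t ω j = Q 0 ω j := by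
        intro t ω
        induction t with
        | zero => rfl
        | succ t ih =>
          rw [← ih]
          funext k
          rw [h.update_apply hw.isDiag, ← hw.sum_eq]
          simp [hrow]
      simp only [h.integral_noise_sq_eq_zero hw (hconst _)]
      exact summable_zero
    · exact h.summable_noise hw (fun i => (hp0 i).le) hp hj m
  have hD := fun t => h.measurable_noise hw.isDiag t j m
  have hint : ∀ t, Integrable (fun ω => (Y t ω j m - Q t ω j m) ^ 2) μ := fun t => by
    simp only [sq]
    exact integrable_mul_of_abs_le_one (hD t) (hD t) (fun ω => h.abs_noise_le_one hw t ω j m)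
      (fun ω => h.abs_noise_le_one hw t ω j m)
  filter_upwards [ae_tendsto_zero_of_summable_integral hint (fun t => (hD t).pow_const 2)
    (fun t ω => sq_nonneg _) hsum] with ω hω
  have h1 := hω.sqrt
  simp only [Real.sqrt_sq_eq_abs, Real.sqrt_zero] at h1
  exact (tendsto_zero_iff_abs_tendsto_zero _).2 h1

/-- Almost surely, the estimates remain probability vectors. -/
theorem ae_sum_eq_one (h : IsAveraging μ A W X Q Y) (hw : IsWeighting A W) :
    ∀ᵐ ω ∂μ, ∀ t i, ∑ m, Q t ω i m = 1 := by
  rw [ae_all_iff]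
  intro t
  induction t with
  | zero => exact Eventually.of_forall fun ω i => h.sum_init ω i
  | succ t ih =>
    have hmsg : ∀ᵐ ω ∂μ, ∀ i, ∑ m, Y t ω i m = 1 := by
      rw [ae_all_iff]
      intro i
      have hint : Integrable (fun ω => ∑ m, Y t ω i m) μ :=
        integrable_finsetSum _ fun m _ => h.integrable_message t i m
      have h1 : ∫ ω, ∑ m, Y t ω i m ∂μ = 1 := by
        rw [integral_finsetSum _ fun m _ => h.integrable_message t i m]
        simp only [h.integral_message hw]
        rw [← integral_finsetSum _ fun m _ => h.integrable hw t i m,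
          integral_congr_ae (g := fun _ => (1 : ℝ)) (by filter_upwards [ih] with ω hω using hω i)]
        simp
      -- The lost mass is nonnegative with mean zero, so silence has probability zero.
      have h2 : ∫ ω, (1 - ∑ m, Y t ω i m) ∂μ = 0 := by
        rw [integral_sub (integrable_const 1) hint, h1]
        simp
      have h3 := (integral_eq_zero_iff_of_nonneg
        (fun ω => sub_nonneg.2 (h.sample.sum_le_one t ω i)) ((integrable_const 1).sub hint)).1 h2
      filter_upwards [h3] with ω hω
      exact (sub_eq_zero.1 hω).symm
    filter_upwards [ih, hmsg] with ω h1 h2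
    intro i
    rw [h.sum_update hw.isDiag, h1]
    simp [h2, hw.sum_eq]

/-- Each column reaches a binary consensus; the limits inherit total mass 1, so exactly one of them
is 1. -/
theorem ae_exists_tendsto (h : IsAveraging μ A W X Q Y) (hw : IsWeighting A W)
    {G : SimpleGraph (Fin n)} (hG : G.Connected) (hW_pos : ∀ i j, 0 < W i j ↔ G.Adj i j)
    (haper : ¬ (G.IsBipartite ∧ ∀ i, A i i = 1)) :
    ∀ᵐ ω ∂μ, ∃ k, Tendsto (fun t => Q t ω) atTop (𝓝 (consensus n (Pi.single k 1))) := by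
  filter_upwards [h.ae_tendsto_noise hw hG hW_pos, h.ae_sum_eq_one hw] with ω hD hsum
  have hb := fun m => exists_consensus_of_tendsto hG hw.nonneg hW_pos hw.sum_eq hw.le_one haper
    (x := fun t i => Q t ω i m) (y := fun t i => Y t ω i m)
    (fun t i => h.sample.binary t ω i m) (fun t i => h.update_apply hw.isDiag t ω i m)
    (fun i => hD i m)
  choose b hb01 hlim using hb
  obtain ⟨i₀⟩ := hG.nonempty
  have hbsum : ∑ m, b m = 1 := by
    have h1 := tendsto_finsetSum Finset.univ fun m _ => hlim m i₀
    simp only [hsum] at h1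
    exact tendsto_nhds_unique h1 tendsto_const_nhds
  have hk : ∃ k, b k = 1 := by
    by_contra! hne
    have : ∀ m, b m = 0 := fun m => (hb01 m).resolve_right (hne m)
    simp [this] at hbsum
  obtain ⟨k, hk⟩ := hk
  have hbk : b = Pi.single k 1 := by
    funext m
    by_cases hm : m = k
    · rw [hm, hk, Pi.single_eq_same]
    · rw [Pi.single_eq_of_ne hm]
      refine (hb01 m).resolve_right fun h1 => ?_
      have h2 : ∑ l ∈ {m, k}, b l ≤ ∑ l, b l :=
        Finset.sum_le_sum_of_subset_of_nonneg (Finset.subset_univ _) fun l _ _ => by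
          rcases hb01 l with h | h <;> simp [h]
      rw [Finset.sum_pair hm, h1, hk, hbsum] at h2
      norm_num at h2
  refine ⟨k, tendsto_pi_nhds.2 fun i => tendsto_pi_nhds.2 fun m => ?_⟩
  simp only [consensus, Matrix.of_apply, ← hbk]
  exact hlim m i

/-- A measurable limit of the estimates. -/
theorem exists_measurable_limit (h : IsAveraging μ A W X Q Y) (hw : IsWeighting A W)
    {G : SimpleGraph (Fin n)} (hG : G.Connected) (hW_pos : ∀ i j, 0 < W i j ↔ G.Adj i j)
    (haper : ¬ (G.IsBipartite ∧ ∀ i, A i i = 1)) :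
    ∃ k : Ω → Fin M, Measurable k ∧
      ∀ᵐ ω ∂μ, Tendsto (fun t => Q t ω) atTop (𝓝 (consensus n (Pi.single (k ω) 1))) := by
  classical
  obtain ⟨i₀⟩ := hG.nonempty
  have hae := h.ae_exists_tendsto hw hG hW_pos haper
  let S : Fin M → Set Ω := fun m => {ω | Tendsto (fun t => Q t ω i₀ m) atTop (𝓝 1)}
  have hS : ∀ m, MeasurableSet (S m) := fun m =>
    measurableSet_tendsto _ fun t => h.measurable hw.isDiag t i₀ m
  have hdisj : ∀ ω m m', ω ∈ S m → ω ∈ S m' → m = m' := by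
    intro ω m m' hm hm'
    by_contra hne
    have hm : Tendsto (fun t => Q t ω i₀ m) atTop (𝓝 1) := hm
    have hm' : Tendsto (fun t => Q t ω i₀ m') atTop (𝓝 1) := hm'
    have h1 : (1 : ℝ) + 1 ≤ 1 := le_of_tendsto' (hm.add hm') fun t => by
      rw [← Finset.sum_pair (f := fun l => Q t ω i₀ l) hne]
      exact (Finset.sum_le_sum_of_subset_of_nonneg (Finset.subset_univ _)
        fun l _ _ => h.nonneg hw t ω i₀ l).trans (h.sum_le_one hw t ω i₀)
    norm_num at h1
  -- The limit is read off at the single agent `i₀`; `X i₀` is an arbitrary value off the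
  -- convergence event.
  let k : Ω → Fin M := fun ω => if hω : ∃ m, ω ∈ S m then hω.choose else X i₀
  have hk : ∀ ω m, ω ∈ S m → k ω = m := by
    intro ω m hm
    have hex : ∃ m, ω ∈ S m := ⟨m, hm⟩
    simp only [k, dif_pos hex]
    exact hdisj ω _ _ hex.choose_spec hm
  refine ⟨k, measurable_to_countable' fun m => ?_, ?_⟩
  · have hpre : k ⁻¹' {m} = S m ∪ {ω | (∀ l, ω ∉ S l) ∧ X i₀ = m} := by
      ext ω
      constructor
      · intro hω
        have hω : k ω = m := hω
        by_cases hex : ∃ l, ω ∈ S l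
        · obtain ⟨l, hl⟩ := hex
          exact Or.inl (hω ▸ hk ω l hl ▸ hl)
        · refine Or.inr ⟨not_exists.1 hex, ?_⟩
          rwa [show k ω = X i₀ from dif_neg hex] at hω
      · rintro (hω | ⟨hω, hm⟩)
        · exact hk ω m hω
        · exact (show k ω = X i₀ from dif_neg (not_exists.2 hω)).trans hm
    rw [hpre]
    refine (hS m).union ?_
    have : {ω | (∀ l, ω ∉ S l) ∧ X i₀ = m} = (⋂ l, (S l)ᶜ) ∩ {_ω | X i₀ = m} := by
      ext ω
      simp
    rw [this]
    exact (MeasurableSet.iInter fun l => (hS l).compl).inter (MeasurableSet.const _)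
  · filter_upwards [hae] with ω ⟨l, hl⟩
    have h1 : ω ∈ S l := by
      have h2 := tendsto_pi_nhds.1 (tendsto_pi_nhds.1 hl i₀) l
      simp only [consensus, Matrix.of_apply, Pi.single_eq_same] at h2
      exact h2
    rwa [hk ω l h1]

/-! ### Conservation of the mean and the main theorem -/

/-- With balanced weights the expected total of the estimates is conserved. -/
theorem sum_integral_eq (h : IsAveraging μ A W X Q Y) (hw : IsWeighting A W)
    (hbal : ∀ j, ∑ i, W i j = A j j) (t : ℕ) (m : Fin M) :
    ∑ i, ∫ ω, Q t ω i m ∂μ = n * empirical X m := by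
  induction t with
  | zero =>
    rcases Nat.eq_zero_or_pos n with rfl | hn
    · simp
    · have : (n : ℝ) ≠ 0 := by positivity
      simp only [h.init, empirical]
      rw [← mul_assoc, mul_one_div_cancel this, one_mul]
      refine Finset.sum_congr rfl fun i _ => ?_
      simp [Pi.single_apply, eq_comm]
  | succ t ih =>
    rw [← ih]
    have h1 : ∀ i, ∫ ω, Q (t + 1) ω i m ∂μ =
        (1 - A i i) * ∫ ω, Q t ω i m ∂μ + ∑ j, W i j * ∫ ω, Q t ω j m ∂μ := by
      intro i
      have hi := fun j => (h.integrable_message t j m).const_mul (W i j)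
      simp only [h.update_apply hw.isDiag]
      rw [integral_add ((h.integrable hw t i m).const_mul _)
        (integrable_finsetSum _ fun j _ => hi j), integral_finsetSum _ fun j _ => hi j]
      simp only [integral_const_mul, h.integral_message hw]
    simp only [h1, Finset.sum_add_distrib]
    rw [Finset.sum_comm (f := fun i j => W i j * ∫ ω, Q t ω j m ∂μ)]
    simp only [← Finset.sum_mul, hbal, ← Finset.sum_add_distrib]
    exact Finset.sum_congr rfl fun i _ => by ring

end IsAveraging

end SocialSampling

theorem mainTheorem6 {n M : ℕ} {Ω : Type*} [MeasurableSpace Ω] (μ : Measure Ω)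
    [IsProbabilityMeasure μ]
    (G : SimpleGraph (Fin n)) (hG : G.Connected)
    (A W : Matrix (Fin n) (Fin n) ℝ)
    (hW_nonneg : ∀ i j, 0 ≤ W i j) (hW_pos : ∀ i j, 0 < W i j ↔ G.Adj i j)
    (hA_diag : A.IsDiag) (hA_sum : ∀ i, ∑ j, W i j = A i i) (hA_le : ∀ i, A i i ≤ 1)
    (h_aper : ¬ (G.IsBipartite ∧ ∀ i, A i i = 1))
    (X : Fin n → Fin M) (Q Y : ℕ → Ω → Matrix (Fin n) (Fin M) ℝ)
    (hQ : SocialSampling.IsAveraging μ A W X Q Y) :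
    ∃ q : Ω → Fin M → ℝ,
      Measurable q ∧
      (∀ ω, ∃ m : Fin M, q ω = Pi.single m 1) ∧
      (∀ᵐ ω ∂μ, Tendsto (fun t => Q t ω) atTop (𝓝 (SocialSampling.consensus n (q ω)))) ∧
      ((∀ j, ∑ i, W i j = A j j) →
        ∀ i m, Integrable (fun ω => SocialSampling.consensus n (q ω) i m) μ ∧
          ∫ ω, SocialSampling.consensus n (q ω) i m ∂μ =
            SocialSampling.consensus n (SocialSampling.empirical X) i m) := by
  have hw : SocialSampling.IsWeighting A W := ⟨hW_nonneg, hA_diag, hA_sum, hA_le⟩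
  obtain ⟨k, hk, hlim⟩ := hQ.exists_measurable_limit hw hG hW_pos h_aper
  have hq : Measurable fun ω => (Pi.single (k ω) 1 : Fin M → ℝ) :=
    (measurable_of_countable fun l : Fin M => (Pi.single l 1 : Fin M → ℝ)).comp hk
  refine ⟨fun ω => Pi.single (k ω) 1, hq, fun ω => ⟨k ω, rfl⟩, hlim, fun hbal i m => ?_⟩
  simp only [SocialSampling.consensus, Matrix.of_apply]
  refine ⟨SocialSampling.integrable_of_mem_unitInterval ((measurable_pi_apply m).comp hq)
    fun ω => ?_, ?_⟩
  · by_cases hm : m = k ω <;> simp [hm]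
  · have hconv : ∀ j, Tendsto (fun t => ∫ ω, Q t ω j m ∂μ) atTop
        (𝓝 (∫ ω, (Pi.single (k ω) 1 : Fin M → ℝ) m ∂μ)) := fun j => by
      refine tendsto_integral_of_dominated_convergence (fun _ => 1)
        (fun t => (hQ.measurable hA_diag t j m).aestronglyMeasurable) (integrable_const 1)
        (fun t => Eventually.of_forall fun ω => hQ.abs_le_one hw t ω j m) ?_
      filter_upwards [hlim] with ω hω
      exact tendsto_pi_nhds.1 (tendsto_pi_nhds.1 hω j) m
    -- Only the total over the agents is conserved; since all rows share one limit, its mean follows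
    -- after division by `n`.
    have h1 := tendsto_finsetSum Finset.univ fun j _ => hconv j
    simp only [hQ.sum_integral_eq hw hbal] at h1
    have h2 := tendsto_nhds_unique h1 tendsto_const_nhds
    have hn : (n : ℝ) ≠ 0 := Nat.cast_ne_zero.2 (Fin.pos i).ne'
    simp only [Finset.sum_const, Finset.card_univ, Fintype.card_fin, nsmul_eq_mul] at h2
    exact mul_left_cancel₀ hn h2
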